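/- Setting. Let $X\subseteq\mathbb R^n$ be a state space, $U\subseteq\mathbb R^m$ a control space, $f(x,u)\in\mathbb R^n$ for $x\in X,\ u\in U$, and $F(x)=\{f(x,u):u\in U\}$. Assume: (SH1) each $F(x)$, $x\in X$, is nonempty and convex, the graph $\mathrm{gr}\,F=\{(x,v):x\in X,\ v\in F(x)\}$ is closed in $X\times\mathbb R^n$, and $F$ is bounded on each compact $K\subseteq X$; (SH2) there are $\gamma,c>0$ with $\|v\|\le\gamma\|x\|+c$ for all $x\in X$, $v\in F(x)$; (SH3) for each compact $K\subseteq X$ there is $k>0$ with $F(x)\subseteq F(y)+k\|x-y\|\,\overline{B_1(0)}$ for all $x,y\in K$. Let the running cost $\psi$ be continuous and positive on $\mathrm{gr}\,F$ (for instance, a continuous function $X\times\mathbb R^n\to(0,\infty)$), let $X_{obst}\subseteq X$ be closed in $X$, and put $X_{free}=X\setminus X_{obst}$. Closures and boundaries of subsets of $X$ are taken relative to $X$. For $x,y\in X$, the set $\Pi(x,y)$ of admissible trajectories consists of all absolutely continuous $\pi:[0,T_\pi]\to X$, $T_\pi\ge 0$, with $\pi'(t)\in F(\pi(t))$ for a.e.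 $t$, $\pi(0)=x$, $\pi(T_\pi)=y$ and $\pi(t)\in\overline{X_{free}}$ for all $t$. The cost of $\pi$ is $c_\pi=\int_0^{T_\pi}\psi(\pi(t),\pi'(t))\,dt$. Put $d_c(x,y)=\inf\{c_\pi:\pi\in\Pi(x,y)\}$ (with $\inf\emptyset=\infty$) and $\mathrm{clr}(x)=\inf_{y\in X_{obst}}d_c(x,y)\in[0,\infty]$. For $\rho>0$ let $W_\rho=\{x\in X_{free}:\mathrm{clr}(x)<\rho\}$. For $x\in X_{free}$ let $\rho_{min}(x)=\inf\{\rho>0:x\in\partial W_\rho\}$ and $\rho_{max}(x)=\sup\{\rho>0:x\in\partial W_\rho\}$ (with $\inf\emptyset=\infty$, $\sup\emptyset=0$), with the convention $\rho_{min}(x)=\rho_{max}(x)=\infty$ if $\mathrm{clr}(x)=\infty$. The wave envelope is $E=\{x\in X_{free}:\rho_{min}(x)<\rho_{max}(x)\}$. Corollary. Let $\pi\in\Pi(x,y)$ be an admissible trajectory such that $t\mapsto\mathrm{clr}(\pi(t))\in[0,\infty]$ is discontinuous at some $\tau\in(0,T_\pi)$. Then both one-sided limits exist in $[0,\infty]$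 and $$\lim_{t\to\tau^-}\mathrm{clr}(\pi(t))<\lim_{t\to\tau^+}\mathrm{clr}(\pi(t)).$$ Further, suppose $\pi(\tau)\in X_{free}$, and suppose that either $\mathrm{clr}(\pi(\tau))<\infty$, or $X$ is closed in $\mathbb R^n$ and the velocities per unit cost have linear growth, i.e. there are $\gamma',c'>0$ with $\|v\|\le(\gamma'\|x\|+c')\,\psi(x,v)$ for all $x\in X$, $v\in F(x)$ (this holds, by (SH2), whenever $\psi$ is bounded below by a positive constant, in particular in the minimal-time case $\psi\equiv1$). Then $\pi(\tau)\in E$. -/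

import Mathlib

open Set Filter Topology MeasureTheory
open scoped ENNReal

/-- An optimal control problem with obstacles: state space `X ⊆ ℝⁿ`, control space `U ⊆ ℝᵐ`,
state function `f`, running cost `ψ`, obstacle set `obst`, and the standing hypotheses on the
velocity sets `{f x u | u ∈ U}`. Only the values of `f` on `X × U` and of `ψ` on the graph of the
velocity multifunction play a role. -/
structure ControlSystem (n m : ℕ) where
  X : Set (EuclideanSpace ℝ (Fin n))
  U : Set (EuclideanSpace ℝ (Fin m))
  f : EuclideanSpace ℝ (Fin n) → EuclideanSpace ℝ (Fin m) → EuclideanSpace ℝ (Fin n)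
  ψ : EuclideanSpace ℝ (Fin n) → EuclideanSpace ℝ (Fin n) → ℝ
  obst : Set (EuclideanSpace ℝ (Fin n))
  /-- the obstacle set is a (relatively) closed subset of the state space -/
  obst_subset : obst ⊆ X
  obst_closed : closure obst ∩ X ⊆ obst
  /-- the running cost is positive and continuous -/
  ψ_pos : ∀ x ∈ X, ∀ v ∈ f x '' U, 0 < ψ x v
  ψ_cont : ContinuousOn (fun p : EuclideanSpace ℝ (Fin n) × EuclideanSpace ℝ (Fin n) => ψ p.1 p.2)
    {p | p.1 ∈ X ∧ p.2 ∈ f p.1 '' U}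
  /-- (SH1) nonempty convex velocity sets, closed graph, local boundedness -/
  vel_nonempty : ∀ x ∈ X, (f x '' U).Nonempty
  vel_convex : ∀ x ∈ X, Convex ℝ (f x '' U)
  graph_closed : ∀ p ∈ closure {p : EuclideanSpace ℝ (Fin n) × EuclideanSpace ℝ (Fin n) |
    p.1 ∈ X ∧ p.2 ∈ f p.1 '' U}, p.1 ∈ X → p.2 ∈ f p.1 '' U
  vel_bounded : ∀ K ⊆ X, IsCompact K → ∃ M > 0, ∀ x ∈ K, ∀ v ∈ f x '' U, ‖v‖ ≤ M
  /-- (SH2) linear growth -/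
  vel_growth : ∃ γ > 0, ∃ c > 0, ∀ x ∈ X, ∀ v ∈ f x '' U, ‖v‖ ≤ γ * ‖x‖ + c
  /-- (SH3) local Lipschitz regularity: `F x ⊆ F y + k ‖x - y‖ B̄` -/
  vel_lipschitz : ∀ K ⊆ X, IsCompact K → ∃ k > 0, ∀ x ∈ K, ∀ y ∈ K,
    ∀ v ∈ f x '' U, ∃ w ∈ f y '' U, ‖v - w‖ ≤ k * ‖x - y‖

namespace ControlSystem

variable {n m : ℕ} (S : ControlSystem n m)

/-- The admissible velocity multifunction `F`. -/
def F (x : EuclideanSpace ℝ (Fin n)) : Set (EuclideanSpace ℝ (Fin n)) :=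
  S.f x '' S.U

/-- Free space. -/
def free : Set (EuclideanSpace ℝ (Fin n)) :=
  S.X \ S.obst

/-- The boundary of `A ⊆ X` relative to the state space `X`. -/
def bdry (A : Set (EuclideanSpace ℝ (Fin n))) : Set (EuclideanSpace ℝ (Fin n)) :=
  S.X ∩ closure A ∩ closure (S.X \ A)

/-- `π : [0,T] → X` is an absolutely continuous solution of the differential inclusion
`π' ∈ F(π)` a.e. on `[0,T]` (equivalently, `π' = f(π, u)` a.e. for some `u` with values in `U`),
moving `x` to `y`. The values of `π` outside `[0,T]` are irrelevant. -/
structure IsUnconstrained (x y : EuclideanSpace ℝ (Fin n)) (T : ℝ)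
    (π : ℝ → EuclideanSpace ℝ (Fin n)) : Prop where
  nonneg : 0 ≤ T
  mem : ∀ t ∈ Icc 0 T, π t ∈ S.X
  absCont : AbsolutelyContinuousOnInterval π 0 T
  deriv_mem : ∀ᵐ t, t ∈ Icc 0 T → ∃ v ∈ S.F (π t), HasDerivAt π v t
  start : π 0 = x
  finish : π T = y

/-- `π ∈ Π(x,y)`: a trajectory from `x` to `y` that stays in the closure of free space. -/
structure IsAdmissible (x y : EuclideanSpace ℝ (Fin n)) (T : ℝ)
    (π : ℝ → EuclideanSpace ℝ (Fin n)) : Prop extends S.IsUnconstrained x y T π where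
  mem_closure : ∀ t ∈ Icc 0 T, π t ∈ closure S.free

/-- The cost `c_π = ∫₀ᵀ ψ(π, π') dt`, with values in `[0,∞]`. -/
noncomputable def cost (T : ℝ) (π : ℝ → EuclideanSpace ℝ (Fin n)) : ℝ≥0∞ :=
  ∫⁻ t in Icc 0 T, ENNReal.ofReal (S.ψ (π t) (deriv π t))

/-- The cost-distance; the infimum is `∞` if there is no admissible trajectory. -/
noncomputable def dist (x y : EuclideanSpace ℝ (Fin n)) : ℝ≥0∞ :=
  ⨅ (T : ℝ) (π : ℝ → EuclideanSpace ℝ (Fin n)) (_ : S.IsAdmissible x y T π), S.cost T π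

/-- The clearance from the obstacle set. -/
noncomputable def clr (x : EuclideanSpace ℝ (Fin n)) : ℝ≥0∞ :=
  ⨅ y ∈ S.obst, S.dist x y

/-- The reverse reachable set `R_ρ(y)`. -/
def reverseReach (ρ : ℝ) (y : EuclideanSpace ℝ (Fin n)) : Set (EuclideanSpace ℝ (Fin n)) :=
  {x | x ∈ S.X ∧ S.dist x y < ENNReal.ofReal ρ}

/-- The propagating wave `W_ρ`. -/
def wave (ρ : ℝ) : Set (EuclideanSpace ℝ (Fin n)) :=
  {x | x ∈ S.free ∧ S.clr x < ENNReal.ofReal ρ}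

/-- In free space, `W_ρ` is the union of the reverse reachable sets of the boundary points of the
obstacle set. -/
theorem wave_eq (ρ : ℝ) :
    S.wave ρ = S.free ∩ ⋃ y ∈ S.bdry S.obst, S.reverseReach ρ y := by
  ext x
  simp only [wave, clr, reverseReach, mem_ofPred_eq, mem_inter_iff, mem_iUnion, exists_prop,
    iInf_lt_iff]
  refine and_congr_right fun hx => ⟨?_, ?_⟩
  · rintro ⟨y, hy, h⟩
    refine ⟨y, ⟨⟨S.obst_subset hy, subset_closure hy⟩, ?_⟩, hx.1, h⟩
    simp only [dist, iInf_lt_iff] at h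
    obtain ⟨T, π, hπ, -⟩ := h
    have := hπ.mem_closure T ⟨hπ.nonneg, le_rfl⟩
    rwa [hπ.finish] at this
  · rintro ⟨y, hy, -, h⟩
    exact ⟨y, S.obst_closed ⟨hy.1.2, hy.1.1⟩, h⟩

open scoped Classical in
/-- First arrival of the wave fronts at `x`; by convention `∞` if `clr x = ∞`. -/
noncomputable def rhoMin (x : EuclideanSpace ℝ (Fin n)) : ℝ≥0∞ :=
  if S.clr x = ∞ then ∞ else ⨅ (ρ : ℝ) (_ : 0 < ρ ∧ x ∈ S.bdry (S.wave ρ)), ENNReal.ofReal ρ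

open scoped Classical in
/-- Last arrival of the wave fronts at `x`; by convention `∞` if `clr x = ∞`. -/
noncomputable def rhoMax (x : EuclideanSpace ℝ (Fin n)) : ℝ≥0∞ :=
  if S.clr x = ∞ then ∞ else ⨆ (ρ : ℝ) (_ : 0 < ρ ∧ x ∈ S.bdry (S.wave ρ)), ENNReal.ofReal ρ

/-- The wave envelope `E`. -/
def envelope : Set (EuclideanSpace ℝ (Fin n)) :=
  {x | x ∈ S.free ∧ S.rhoMin x < S.rhoMax x}

/-- The velocities per unit of cost, `v / ψ(x,v)` with `v ∈ F(x)`, have linear growth. If `ψ = 1`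
this is (SH2), and it follows from (SH2) whenever `ψ` is bounded below by a positive constant. -/
def CostLinearGrowth : Prop :=
  ∃ γ > 0, ∃ c > 0, ∀ x ∈ S.X, ∀ v ∈ S.F x, ‖v‖ ≤ (γ * ‖x‖ + c) * S.ψ x v

end ControlSystem

/-! Over the compact image of a trajectory the velocity graph is compact, so `ψ` has an upper bound
`B` there. Concatenating a piece of `π` with a trajectory to the obstacle gives `clr (π s) ≤ B (t -
s) + clr (π t)` for `s ≤ t` (`IsAdmissible.exists_clr_le`). Hence `clr (π t) + B t` is
nondecreasing: the one-sided limits `L`, `R` at `τ` exist, `L ≤ clr (π τ) ≤ R`, and a discontinuity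
forces `L < R`.

For every `ρ` strictly between `L` and `R`, the point `π τ` is a limit of points of `W_ρ` from the
left and of points outside it from the right. It therefore lies on the boundary of `W_ρ` for a whole
interval of `ρ`, which separates first from last arrival (`IsAdmissible.mem_bdry_wave`).

What remains is the convention for `clr (π τ) = ∞`. Points just before `τ` reach the obstacle at
cost below some finite `C`. A Gronwall estimate confines these trajectories to one compact set,
where a lower bound on `ψ` bounds their durations. A limit of them joins `π τ` to the obstacle
(`clr_lt_top_of_tendsto`). Its cost is finite like that of any trajectory, so no semicontinuity of
the cost is needed. -/

section AbsolutelyContinuous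

/-! ### Absolutely continuous curves and mean value estimates. -/

variable {E : Type*} [NormedAddCommGroup E]

theorem LipschitzOnWith.comp_absolutelyContinuousOnInterval {E' : Type*} [NormedAddCommGroup E']
    {f : ℝ → E} {g : E → E'} {a b : ℝ} {K : NNReal} {s : Set E} (hg : LipschitzOnWith K g s)
    (hf : AbsolutelyContinuousOnInterval f a b) (hs : MapsTo f (uIcc a b) s) :
    AbsolutelyContinuousOnInterval (g ∘ f) a b := by
  rw [absolutelyContinuousOnInterval_iff] at hf ⊢
  intro ε hε
  obtain ⟨δ, hδ, h⟩ := hf (ε / (K + 1)) (by positivity)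
  refine ⟨δ, hδ, fun I hI hlt => ?_⟩
  have h1 := h I hI hlt
  calc ∑ i ∈ Finset.range I.1, dist ((g ∘ f) (I.2 i).1) ((g ∘ f) (I.2 i).2)
      ≤ ∑ i ∈ Finset.range I.1, K * dist (f (I.2 i).1) (f (I.2 i).2) :=
        Finset.sum_le_sum fun i hi =>
          hg.dist_le_mul _ (hs (hI.1 i hi).1) _ (hs (hI.1 i hi).2)
    _ = K * ∑ i ∈ Finset.range I.1, dist (f (I.2 i).1) (f (I.2 i).2) := by
        rw [Finset.mul_sum]
    _ ≤ K * (ε / (K + 1)) := by gcongr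
    _ < (K + 1) * (ε / (K + 1)) := by gcongr; linarith
    _ = ε := by field_simp

theorem LipschitzOnWith.Icc_union_Icc {f : ℝ → E} {a b c : ℝ} {K : NNReal}
    (h₁ : LipschitzOnWith K f (Icc a b)) (h₂ : LipschitzOnWith K f (Icc b c)) :
    LipschitzOnWith K f (Icc a c) := by
  refine LipschitzOnWith.of_dist_le_mul fun s hs t ht => ?_
  wlog hst : s ≤ t generalizing s t
  · rw [dist_comm, dist_comm s]; exact this t ht s hs (le_of_not_ge hst)
  rcases le_total t b with htb | hbt
  · exact h₁.dist_le_mul s ⟨hs.1, hst.trans htb⟩ t ⟨ht.1, htb⟩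
  rcases le_total b s with hbs | hsb
  · exact h₂.dist_le_mul s ⟨hbs, hs.2⟩ t ⟨hbt, ht.2⟩
  have e₁ := h₁.dist_le_mul s ⟨hs.1, hsb⟩ b ⟨hs.1.trans hsb, le_rfl⟩
  have e₂ := h₂.dist_le_mul b ⟨le_rfl, hbt.trans ht.2⟩ t ⟨hbt, ht.2⟩
  have e₃ := dist_triangle (f s) (f b) (f t)
  rw [Real.dist_eq, abs_sub_comm, abs_of_nonneg (by linarith)] at e₁ e₂ ⊢
  nlinarith

variable [NormedSpace ℝ E]

/-- The mean value inclusion for absolutely continuous functions. -/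
theorem AbsolutelyContinuousOnInterval.smul_sub_mem_of_convex {f : ℝ → E} {a b : ℝ} (hab : a < b)
    (hf : AbsolutelyContinuousOnInterval f a b) {C : Set E} (hC : Convex ℝ C) (hCc : IsClosed C)
    (h : ∀ᵐ t, t ∈ Icc a b → ∃ v ∈ C, HasDerivAt f v t) :
    (b - a)⁻¹ • (f b - f a) ∈ C := by
  -- Separate the difference quotient from `C` by a functional `l`; integrating `(l ∘ f)' ≤ u`
  -- contradicts the separation.
  by_contra hnot
  obtain ⟨l, u, hl, hu⟩ := geometric_hahn_banach_closed_point hC hCc hnot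
  have hac : AbsolutelyContinuousOnInterval (l ∘ f) a b :=
    (l.lipschitz.lipschitzOnWith (s := univ)).comp_absolutelyContinuousOnInterval hf
      fun _ _ => mem_univ _
  have hint := hac.integral_deriv_eq_sub
  have hle : ∫ t in a..b, deriv (l ∘ f) t ≤ ∫ _ in a..b, u := by
    refine intervalIntegral.integral_mono_ae_restrict hab.le hac.intervalIntegrable_deriv
      intervalIntegrable_const ?_
    rw [EventuallyLE, ae_restrict_iff' measurableSet_Icc]
    filter_upwards [h] with t ht hmem
    obtain ⟨v, hv, hd⟩ := ht hmem
    rw [(l.hasFDerivAt.comp_hasDerivAt t hd).deriv]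
    exact (hl v hv).le
  rw [hint, intervalIntegral.integral_const, smul_eq_mul] at hle
  rw [map_smul, map_sub, smul_eq_mul] at hu
  have hpos : 0 < b - a := sub_pos.2 hab
  rw [inv_mul_eq_div, lt_div_iff₀ hpos] at hu
  simp only [Function.comp_apply] at hle
  nlinarith

/-- The mean value inclusion applied to the closed ball of radius `M`. -/
theorem AbsolutelyContinuousOnInterval.lipschitzOnWith_of_ae_norm_deriv_le {f : ℝ → E} {a b : ℝ}
    (hf : AbsolutelyContinuousOnInterval f a b) {M : NNReal}
    (h : ∀ᵐ t, t ∈ Icc a b → ∃ v, ‖v‖ ≤ M ∧ HasDerivAt f v t) :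
    LipschitzOnWith M f (Icc a b) := by
  refine LipschitzOnWith.of_dist_le_mul fun s hs t ht => ?_
  wlog hst : s ≤ t generalizing s t
  · rw [dist_comm, dist_comm s]; exact this t ht s hs (le_of_not_ge hst)
  rcases hst.eq_or_lt with rfl | hlt
  · simp
  have hsub : Icc s t ⊆ Icc a b := Icc_subset_Icc hs.1 ht.2
  have hmem := (hf.mono (c := s) (d := t) (by
    rw [uIcc_of_le hst]; exact hsub.trans Icc_subset_uIcc)).smul_sub_mem_of_convex hlt
    (convex_closedBall (0 : E) M) Metric.isClosed_closedBall (by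
      filter_upwards [h] with r hr hmem
      obtain ⟨v, hv, hd⟩ := hr (hsub hmem)
      exact ⟨v, by simpa using hv, hd⟩)
  have hpos : 0 < t - s := sub_pos.2 hlt
  rw [mem_closedBall_zero_iff, norm_smul, norm_inv, Real.norm_of_nonneg hpos.le,
    inv_mul_eq_div, div_le_iff₀ hpos] at hmem
  rw [dist_comm, dist_comm s, dist_eq_norm, Real.dist_eq, abs_of_pos hpos]
  exact hmem

/-- If `f` is absolutely continuous with `f' ≤ g` a.e., then `f b - f a ≤ ∫ g`. -/
theorem AbsolutelyContinuousOnInterval.sub_le_toReal_lintegral {f : ℝ → ℝ} {a b : ℝ}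
    (hab : a ≤ b) (hf : AbsolutelyContinuousOnInterval f a b) {g : ℝ → ℝ≥0∞}
    (h : ∀ᵐ t, t ∈ Icc a b → ENNReal.ofReal (deriv f t) ≤ g t)
    (hg : ∫⁻ t in Icc a b, g t ≠ ∞) :
    f b - f a ≤ (∫⁻ t in Icc a b, g t).toReal := by
  rw [← hf.integral_deriv_eq_sub, intervalIntegral.integral_of_le hab,
    ← integral_Icc_eq_integral_Ioc,
    integral_eq_lintegral_pos_part_sub_lintegral_neg_part
      ((intervalIntegrable_iff_integrableOn_Icc_of_le hab).1 hf.intervalIntegrable_deriv)]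
  refine (sub_le_self _ ENNReal.toReal_nonneg).trans (ENNReal.toReal_mono hg ?_)
  refine lintegral_mono_ae ?_
  rw [ae_restrict_iff' measurableSet_Icc]
  exact h

end AbsolutelyContinuous

/-! ### Bounds on compact sets; restriction and concatenation of trajectories. -/

namespace ControlSystem

variable {n m : ℕ} {S : ControlSystem n m}

theorem isCompact_graph {K : Set (EuclideanSpace ℝ (Fin n))} (hK : IsCompact K) (hKX : K ⊆ S.X) :
    IsCompact {p : EuclideanSpace ℝ (Fin n) × EuclideanSpace ℝ (Fin n) |
      p.1 ∈ K ∧ p.2 ∈ S.F p.1} := by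
  obtain ⟨M, -, hM⟩ := S.vel_bounded K hKX hK
  refine (hK.prod (isCompact_closedBall (0 : EuclideanSpace ℝ (Fin n)) M)).of_isClosed_subset ?_ ?_
  · refine isClosed_of_closure_subset fun p hp => ?_
    have h1 : p.1 ∈ K := by
      have := map_mem_closure (t := K) continuous_fst hp fun q hq => hq.1
      rwa [hK.isClosed.closure_eq] at this
    refine ⟨h1, S.graph_closed p (closure_mono ?_ hp) (hKX h1)⟩
    exact fun q hq => ⟨hKX hq.1, hq.2⟩
  · intro p hp
    exact ⟨hp.1, by simpa using hM p.1 hp.1 p.2 hp.2⟩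

theorem isClosed_F {x : EuclideanSpace ℝ (Fin n)} (hx : x ∈ S.X) : IsClosed (S.F x) := by
  refine isClosed_of_closure_subset fun v hv => S.graph_closed (x, v) ?_ hx
  exact map_mem_closure (f := fun w : EuclideanSpace ℝ (Fin n) => (x, w)) (by fun_prop) hv
    fun w hw => ⟨hx, hw⟩

theorem exists_bounds_of_isCompact {K : Set (EuclideanSpace ℝ (Fin n))} (hK : IsCompact K)
    (hKX : K ⊆ S.X) :
    ∃ a > 0, ∃ B > 0, ∀ x ∈ K, ∀ v ∈ S.F x, a ≤ S.ψ x v ∧ S.ψ x v ≤ B := by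
  have hG := isCompact_graph hK hKX
  set Γ := {p : EuclideanSpace ℝ (Fin n) × EuclideanSpace ℝ (Fin n) | p.1 ∈ K ∧ p.2 ∈ S.F p.1}
  have hc : ContinuousOn (fun p : EuclideanSpace ℝ (Fin n) × EuclideanSpace ℝ (Fin n) =>
      S.ψ p.1 p.2) Γ :=
    S.ψ_cont.mono fun p hp => ⟨hKX hp.1, hp.2⟩
  rcases eq_empty_or_nonempty Γ with he | hne
  · refine ⟨1, one_pos, 1, one_pos, fun x hx v hv => ?_⟩
    have : (x, v) ∈ Γ := ⟨hx, hv⟩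
    rw [he] at this; exact this.elim
  · obtain ⟨p, hp, hmin⟩ := hG.exists_isMinOn hne hc
    obtain ⟨q, hq, hmax⟩ := hG.exists_isMaxOn hne hc
    exact ⟨_, S.ψ_pos p.1 (hKX hp.1) p.2 hp.2, _, S.ψ_pos q.1 (hKX hq.1) q.2 hq.2,
      fun x hx v hv => ⟨isMinOn_iff.1 hmin (x, v) ⟨hx, hv⟩, isMaxOn_iff.1 hmax (x, v) ⟨hx, hv⟩⟩⟩

namespace IsAdmissible

variable {x y z : EuclideanSpace ℝ (Fin n)} {T T' : ℝ} {π σ : ℝ → EuclideanSpace ℝ (Fin n)}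

theorem continuousOn (h : S.IsAdmissible x y T π) : ContinuousOn π (Icc 0 T) := by
  have := h.absCont.continuousOn
  rwa [uIcc_of_le h.nonneg] at this

theorem isCompact_image (h : S.IsAdmissible x y T π) : IsCompact (π '' Icc 0 T) :=
  isCompact_Icc.image_of_continuousOn h.continuousOn

theorem image_subset (h : S.IsAdmissible x y T π) : π '' Icc 0 T ⊆ S.X := by
  rintro _ ⟨t, ht, rfl⟩
  exact h.mem t ht

theorem lipschitzOnWith_of_bound (h : S.IsAdmissible x y T π) {M : NNReal}
    (hM : ∀ t ∈ Icc 0 T, ∀ v ∈ S.F (π t), ‖v‖ ≤ M) : LipschitzOnWith M π (Icc 0 T) := by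
  refine h.absCont.lipschitzOnWith_of_ae_norm_deriv_le ?_
  filter_upwards [h.deriv_mem] with t ht hmem
  obtain ⟨v, hv, hd⟩ := ht hmem
  exact ⟨v, hM t hmem v hv, hd⟩

/-- Velocities are bounded over the compact image. Being Lipschitz, unlike mere absolute continuity,
is immediate to shift and glue. -/
theorem exists_lipschitzOnWith (h : S.IsAdmissible x y T π) :
    ∃ M, LipschitzOnWith M π (Icc 0 T) := by
  obtain ⟨M, hM0, hM⟩ := S.vel_bounded _ h.image_subset h.isCompact_image
  exact ⟨⟨M, hM0.le⟩, h.lipschitzOnWith_of_bound fun t ht v hv =>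
    hM _ (mem_image_of_mem _ ht) v hv⟩

theorem cost_le (h : S.IsAdmissible x y T π) {B : ℝ} (hB : 0 ≤ B)
    (hψ : ∀ t ∈ Icc 0 T, ∀ v ∈ S.F (π t), S.ψ (π t) v ≤ B) :
    S.cost T π ≤ ENNReal.ofReal (B * T) := by
  calc S.cost T π ≤ ∫⁻ _ in Icc 0 T, ENNReal.ofReal B := by
        refine lintegral_mono_ae ?_
        rw [ae_restrict_iff' measurableSet_Icc]
        filter_upwards [h.deriv_mem] with t ht hmem
        obtain ⟨v, hv, hd⟩ := ht hmem
        rw [hd.deriv]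
        exact ENNReal.ofReal_le_ofReal (hψ t hmem v hv)
    _ = ENNReal.ofReal (B * T) := by
        rw [setLIntegral_const, Real.volume_Icc, sub_zero, ENNReal.ofReal_mul hB]

theorem le_cost (h : S.IsAdmissible x y T π) {a : ℝ} (ha : 0 ≤ a)
    (hψ : ∀ t ∈ Icc 0 T, ∀ v ∈ S.F (π t), a ≤ S.ψ (π t) v) :
    ENNReal.ofReal (a * T) ≤ S.cost T π := by
  calc ENNReal.ofReal (a * T) = ∫⁻ _ in Icc 0 T, ENNReal.ofReal a := by
        rw [setLIntegral_const, Real.volume_Icc, sub_zero, ENNReal.ofReal_mul ha]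
    _ ≤ S.cost T π := by
        refine lintegral_mono_ae ?_
        rw [ae_restrict_iff' measurableSet_Icc]
        filter_upwards [h.deriv_mem] with t ht hmem
        obtain ⟨v, hv, hd⟩ := ht hmem
        rw [hd.deriv]
        exact ENNReal.ofReal_le_ofReal (hψ t hmem v hv)

theorem cost_lt_top (h : S.IsAdmissible x y T π) : S.cost T π < ∞ := by
  obtain ⟨_, _, B, hB, hψ⟩ := exists_bounds_of_isCompact h.isCompact_image h.image_subset
  exact (h.cost_le hB.le fun t ht v hv => (hψ _ (mem_image_of_mem _ ht) v hv).2).trans_lt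
    ENNReal.ofReal_lt_top

theorem restrict (h : S.IsAdmissible x y T π) {s t : ℝ} (hs : 0 ≤ s) (hst : s ≤ t) (ht : t ≤ T) :
    S.IsAdmissible (π s) (π t) (t - s) (fun r => π (r + s)) := by
  have hmaps : ∀ r ∈ Icc 0 (t - s), r + s ∈ Icc 0 T := fun r hr =>
    ⟨by linarith [hr.1], by linarith [hr.2]⟩
  obtain ⟨M, hM⟩ := h.exists_lipschitzOnWith
  refine ⟨⟨by linarith, fun r hr => h.mem _ (hmaps r hr), ?_, ?_, by simp, by simp⟩,
    fun r hr => h.mem_closure _ (hmaps r hr)⟩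
  · refine LipschitzOnWith.absolutelyContinuousOnInterval (K := M) ?_
    rw [uIcc_of_le (by linarith)]
    refine LipschitzOnWith.of_dist_le_mul fun p hp q hq => ?_
    simpa using hM.dist_le_mul _ (hmaps p hp) _ (hmaps q hq)
  · filter_upwards [(quasiMeasurePreserving_add_right volume s).ae h.deriv_mem] with r hr hmem
    obtain ⟨v, hv, hd⟩ := hr (hmaps r hmem)
    exact ⟨v, hv, hd.comp_add_const r s⟩

theorem concat (h : S.IsAdmissible x y T π) (h' : S.IsAdmissible y z T' σ) :
    S.IsAdmissible x z (T + T') (fun r => if r ≤ T then π r else σ (r + -T)) ∧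
    S.cost (T + T') (fun r => if r ≤ T then π r else σ (r + -T)) ≤ S.cost T π + S.cost T' σ := by
  set q : ℝ → EuclideanSpace ℝ (Fin n) := fun r => if r ≤ T then π r else σ (r + -T) with hq
  have hT := h.nonneg
  have hT' := h'.nonneg
  have q₁ : ∀ r ≤ T, q r = π r := fun r hr => if_pos hr
  have q₂ : ∀ r, T ≤ r → q r = σ (r + -T) := by
    intro r hr
    rcases hr.eq_or_lt with rfl | hlt
    · rw [q₁ _ le_rfl, h.finish, add_neg_cancel, h'.start]
    · exact if_neg (not_le.2 hlt)
  have d₁ : ∀ r < T, q =ᶠ[𝓝 r] π := fun r hr => by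
    filter_upwards [Iio_mem_nhds hr] with s hs using q₁ s (le_of_lt hs)
  have d₂ : ∀ r > T, q =ᶠ[𝓝 r] fun r => σ (r + -T) := fun r hr => by
    filter_upwards [Ioi_mem_nhds hr] with s hs using q₂ s (le_of_lt hs)
  have maps₂ : ∀ r ∈ Icc T (T + T'), r + -T ∈ Icc 0 T' := fun r hr =>
    ⟨by linarith [hr.1], by linarith [hr.2]⟩
  obtain ⟨M, hM⟩ := h.exists_lipschitzOnWith
  obtain ⟨M', hM'⟩ := h'.exists_lipschitzOnWith
  -- The junction time, where the derivative may fail to exist, is a null set.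
  have hne : ∀ᵐ r : ℝ, r ≠ T := by simp [ae_iff, measure_singleton]
  have hσ := (quasiMeasurePreserving_add_right volume (-T)).ae h'.deriv_mem
  refine ⟨⟨⟨by linarith, ?_, ?_, ?_, ?_, ?_⟩, ?_⟩, ?_⟩
  · intro r hr
    rcases le_total r T with hrT | hrT
    · rw [q₁ r hrT]; exact h.mem r ⟨hr.1, hrT⟩
    · rw [q₂ r hrT]; exact h'.mem _ (maps₂ r ⟨hrT, hr.2⟩)
  · refine LipschitzOnWith.absolutelyContinuousOnInterval (K := max M M') ?_
    rw [uIcc_of_le (by linarith)]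
    refine LipschitzOnWith.Icc_union_Icc (b := T) ?_ ?_
    · refine LipschitzOnWith.of_dist_le_mul fun r hr s hs => ?_
      rw [q₁ r hr.2, q₁ s hs.2]
      exact (hM.weaken (le_max_left M M')).dist_le_mul r hr s hs
    · refine LipschitzOnWith.of_dist_le_mul fun r hr s hs => ?_
      rw [q₂ r hr.1, q₂ s hs.1]
      simpa using (hM'.weaken (le_max_right M M')).dist_le_mul _ (maps₂ r hr) _ (maps₂ s hs)
  · filter_upwards [h.deriv_mem, hσ, hne] with r hr hr' hrT hmem
    rcases lt_or_gt_of_ne hrT with hlt | hgt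
    · obtain ⟨v, hv, hd⟩ := hr ⟨hmem.1, hlt.le⟩
      exact ⟨v, by rwa [q₁ r hlt.le], hd.congr_of_eventuallyEq (d₁ r hlt)⟩
    · obtain ⟨v, hv, hd⟩ := hr' (maps₂ r ⟨hgt.le, hmem.2⟩)
      exact ⟨v, by rwa [q₂ r hgt.le],
        (hd.comp_add_const r (-T)).congr_of_eventuallyEq (d₂ r hgt)⟩
  · rw [q₁ 0 hT, h.start]
  · rw [q₂ _ (by linarith), show T + T' + -T = T' by ring, h'.finish]
  · intro r hr
    rcases le_total r T with hrT | hrT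
    · rw [q₁ r hrT]; exact h.mem_closure r ⟨hr.1, hrT⟩
    · rw [q₂ r hrT]; exact h'.mem_closure _ (maps₂ r ⟨hrT, hr.2⟩)
  · rw [cost, ← Icc_union_Icc_eq_Icc hT (by linarith : T ≤ T + T')]
    refine (lintegral_union_le _ _ _).trans (add_le_add (le_of_eq ?_) (le_of_eq ?_))
    · refine lintegral_congr_ae ?_
      rw [EventuallyEq, ae_restrict_iff' measurableSet_Icc]
      filter_upwards [hne] with r hr hmem
      rw [q₁ r hmem.2, (d₁ r (lt_of_le_of_ne hmem.2 hr)).deriv_eq]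
    · have hpre : Icc T (T + T') = (fun r => r + -T) ⁻¹' Icc 0 T' := by
        ext r
        simp only [mem_Icc, mem_preimage]
        constructor <;> rintro ⟨h1, h2⟩ <;> constructor <;> linarith
      rw [cost, ← (measurePreserving_add_right volume (-T)).setLIntegral_comp_preimage_emb
        (measurableEmbedding_addRight (-T)) (fun t => ENNReal.ofReal (S.ψ (σ t) (deriv σ t))),
        ← hpre]
      refine lintegral_congr_ae ?_
      rw [EventuallyEq, ae_restrict_iff' measurableSet_Icc]
      filter_upwards [hne] with r hr hmem
      rw [q₂ r hmem.1, (d₂ r (lt_of_le_of_ne hmem.1 hr.symm)).deriv_eq,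
        deriv_comp_add_const]

theorem dist_le (h : S.IsAdmissible x y T π) : S.dist x y ≤ S.cost T π :=
  iInf_le_of_le T <| iInf_le_of_le π <| iInf_le _ h

end IsAdmissible

/-! ### The clearance along a trajectory. -/

theorem dist_triangle (x y z : EuclideanSpace ℝ (Fin n)) :
    S.dist x z ≤ S.dist x y + S.dist y z := by
  simp only [dist.eq_1 S x y, dist.eq_1 S y z, ENNReal.iInf_add, ENNReal.add_iInf]
  refine le_iInf fun T' => le_iInf fun σ => le_iInf fun h' => le_iInf fun T => le_iInf fun π =>
    le_iInf fun h => ?_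
  exact (h.concat h').1.dist_le.trans (h.concat h').2

theorem clr_le_dist_add (x y : EuclideanSpace ℝ (Fin n)) : S.clr x ≤ S.dist x y + S.clr y := by
  rw [clr, clr]
  simp only [ENNReal.add_iInf]
  exact le_iInf fun z => le_iInf fun hz =>
    (iInf_le_of_le z (iInf_le _ hz)).trans (dist_triangle x y z)

/-- Along an admissible trajectory the clearance decreases at most linearly. -/
theorem IsAdmissible.exists_clr_le {x y : EuclideanSpace ℝ (Fin n)} {T : ℝ}
    {π : ℝ → EuclideanSpace ℝ (Fin n)} (h : S.IsAdmissible x y T π) :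
    ∃ B > 0, ∀ s t, 0 ≤ s → s ≤ t → t ≤ T →
      S.clr (π s) ≤ ENNReal.ofReal (B * (t - s)) + S.clr (π t) := by
  obtain ⟨_, _, B, hB, hψ⟩ := exists_bounds_of_isCompact h.isCompact_image h.image_subset
  refine ⟨B, hB, fun s t hs hst ht => (clr_le_dist_add (π s) (π t)).trans ?_⟩
  gcongr
  have h' := h.restrict hs hst ht
  exact h'.dist_le.trans <| h'.cost_le hB.le fun r hr v hv =>
    (hψ _ (mem_image_of_mem _ ⟨by linarith [hr.1], by linarith [hr.2]⟩) v hv).2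

theorem IsAdmissible.exists_clr_limits {x y : EuclideanSpace ℝ (Fin n)} {T : ℝ}
    {π : ℝ → EuclideanSpace ℝ (Fin n)} (h : S.IsAdmissible x y T π) {τ : ℝ} (hτ : τ ∈ Ioo 0 T) :
    ∃ L R : ℝ≥0∞, Tendsto (fun t => S.clr (π t)) (𝓝[<] τ) (𝓝 L) ∧
      Tendsto (fun t => S.clr (π t)) (𝓝[>] τ) (𝓝 R) ∧ L ≤ S.clr (π τ) ∧ S.clr (π τ) ≤ R := by
  obtain ⟨B, hB, hclr⟩ := h.exists_clr_le
  set g : ℝ → ℝ≥0∞ := fun t => S.clr (π t) with hg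
  set C : ℝ → ℝ≥0∞ := fun t => ENNReal.ofReal (B * t) with hC
  have hCc : Continuous C := ENNReal.continuous_ofReal.comp (by fun_prop)
  have hmono : MonotoneOn (fun t => g t + C t) (Icc 0 T) := by
    intro s hs t ht hst
    calc g s + C s ≤ ENNReal.ofReal (B * (t - s)) + g t + C s := by
          gcongr; exact hclr s t hs.1 hst ht.2
      _ = g t + C t := by
          have : C t = ENNReal.ofReal (B * (t - s)) + C s := by
            rw [hC]
            simp only
            rw [← ENNReal.ofReal_add (mul_nonneg hB.le (by linarith)) (mul_nonneg hB.le hs.1)]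
            ring_nf
          rw [this]; ring
  -- Since `C` is finite and continuous, it can be subtracted from a limit even where `g` is
  -- infinite.
  have key : ∀ {l : Filter ℝ} {A : ℝ≥0∞}, l ≤ 𝓝 τ → Tendsto (fun t => g t + C t) l (𝓝 A) →
      Tendsto g l (𝓝 (A - C τ)) := by
    intro l A hl hA
    have := ENNReal.Tendsto.sub hA (hCc.tendsto τ |>.mono_left hl) (Or.inr ENNReal.ofReal_ne_top)
    refine this.congr fun t => ENNReal.add_sub_cancel_right ENNReal.ofReal_ne_top
  have hτm : τ ∈ Icc 0 T := ⟨hτ.1.le, hτ.2.le⟩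
  have hL := MonotoneOn.tendsto_nhdsWithin_Ioo_left (nonempty_Ioo.2 hτ.1)
    (hmono.mono fun t ht => ⟨ht.1.le, ht.2.le.trans hτ.2.le⟩) (OrderTop.bddAbove _)
  have hR := MonotoneOn.tendsto_nhdsWithin_Ioo_right (nonempty_Ioo.2 hτ.2)
    (hmono.mono fun t ht => ⟨hτ.1.le.trans ht.1.le, ht.2.le⟩) (OrderBot.bddBelow _)
  refine ⟨_, _, key nhdsWithin_le_nhds hL, key nhdsWithin_le_nhds hR, ?_, ?_⟩
  · refine tsub_le_iff_right.2 (sSup_le ?_)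
    rintro _ ⟨t, ht, rfl⟩
    exact hmono ⟨ht.1.le, ht.2.le.trans hτ.2.le⟩ hτm ht.2.le
  · refine ENNReal.le_sub_of_add_le_right ENNReal.ofReal_ne_top (le_sInf ?_)
    rintro _ ⟨t, ht, rfl⟩
    exact hmono hτm ⟨hτ.1.le.trans ht.1.le, ht.2.le⟩ ht.1.le

end ControlSystem

/-! ### Limits of trajectories, the Gronwall bound and finiteness of the clearance. -/

namespace ControlSystem

variable {n m : ℕ} {S : ControlSystem n m}

theorem F_subset_cthickening {K : Set (EuclideanSpace ℝ (Fin n))} {k δ : ℝ}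
    (hk : ∀ x ∈ K, ∀ y ∈ K, ∀ v ∈ S.f x '' S.U, ∃ w ∈ S.f y '' S.U, ‖v - w‖ ≤ k * ‖x - y‖)
    {x y : EuclideanSpace ℝ (Fin n)} (hx : x ∈ K) (hy : y ∈ K) (hδ : k * ‖x - y‖ ≤ δ) :
    S.F x ⊆ Metric.cthickening δ (S.F y) := by
  intro v hv
  obtain ⟨w, hw, h⟩ := hk x hx y hy v hv
  exact Metric.mem_cthickening_of_dist_le v w δ _ hw (by rw [dist_eq_norm]; exact h.trans hδ)

/-- Pointwise limits of clamped admissible trajectories of bounded duration in a compact set are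
admissible trajectories. -/
theorem exists_isAdmissible_of_ultrafilter {ι : Type*} {l : Ultrafilter ι}
    {K : Set (EuclideanSpace ℝ (Fin n))} (hK : IsCompact K) (hKX : K ⊆ S.X)
    {p y : ι → EuclideanSpace ℝ (Fin n)} {T : ι → ℝ} {q : ι → ℝ → EuclideanSpace ℝ (Fin n)}
    {Tm : ℝ} (hq : ∀ᶠ i in l, S.IsAdmissible (p i) (y i) (T i) (q i) ∧ T i ≤ Tm ∧
      ∀ t ∈ Icc 0 (T i), q i t ∈ K) :
    ∃ x z T' π, S.IsAdmissible x z T' π ∧ Tendsto p l (𝓝 x) ∧ Tendsto y l (𝓝 z) := by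
  obtain ⟨M, hM0, hM⟩ := S.vel_bounded K hKX hK
  obtain ⟨k, hk0, hk⟩ := S.vel_lipschitz K hKX hK
  -- Clamping time extends each curve by constants, giving a common domain and Lipschitz constant
  -- `M` despite the varying durations.
  set Q : ι → ℝ → EuclideanSpace ℝ (Fin n) := fun i t => q i (max 0 (min t (T i))) with hQ
  have hlip : ∀ᶠ i in l, ∀ s t, ‖Q i s - Q i t‖ ≤ M * |s - t| := by
    filter_upwards [hq] with i ⟨hi, _, hiK⟩ s t
    have h1 := (hi.lipschitzOnWith_of_bound (M := ⟨M, hM0.le⟩)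
      fun t ht v hv => hM _ (hiK t ht) v hv).dist_le_mul
    have hc : ∀ t, max 0 (min t (T i)) ∈ Icc 0 (T i) := fun t =>
      ⟨le_max_left _ _, max_le hi.nonneg (min_le_right _ _)⟩
    have h2 := h1 _ (hc s) _ (hc t)
    rw [dist_eq_norm, Real.dist_eq] at h2
    refine h2.trans (mul_le_mul_of_nonneg_left ?_ hM0.le)
    rw [max_comm 0, max_comm 0]
    exact (abs_max_sub_max_le_abs _ _ _).trans (by
      simpa using abs_min_sub_min_le_max s (T i) t (T i))
  have hQK : ∀ᶠ i in l, ∀ t, Q i t ∈ K ∩ closure S.free := by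
    filter_upwards [hq] with i ⟨hi, _, hiK⟩ t
    have hc : max 0 (min t (T i)) ∈ Icc 0 (T i) :=
      ⟨le_max_left _ _, max_le hi.nonneg (min_le_right _ _)⟩
    exact ⟨hiK _ hc, hi.mem_closure _ hc⟩
  have hKc : IsCompact (K ∩ closure S.free) := hK.inter_right isClosed_closure
  -- Along an ultrafilter, compactness gives all pointwise limits at once, without extracting
  -- subsequences.
  have hlim : ∀ t, ∃ z ∈ K ∩ closure S.free, Tendsto (fun i => Q i t) l (𝓝 z) := fun t =>
    hKc.ultrafilter_le_nhds' (l.map fun i => Q i t) (hQK.mono fun i hi => hi t)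
  choose π hπK hπ using hlim
  obtain ⟨T', hT'm, hT'⟩ : ∃ T' ∈ Icc 0 Tm, Tendsto T l (𝓝 T') :=
    isCompact_Icc.ultrafilter_le_nhds' (l.map T)
      (hq.mono fun i hi => ⟨hi.1.nonneg, hi.2.1⟩)
  have hπlip : ∀ s t, ‖π s - π t‖ ≤ M * |s - t| := fun s t =>
    le_of_tendsto ((hπ s).sub (hπ t)).norm (hlip.mono fun i hi => hi s t)
  have hπL : LipschitzWith ⟨M, hM0.le⟩ π := LipschitzWith.of_dist_le_mul fun s t => by
    rw [dist_eq_norm, Real.dist_eq]; exact hπlip s t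
  refine ⟨π 0, π T', T', π, ⟨⟨hT'm.1, fun t _ => hKX (hπK t).1,
    hπL.lipschitzOnWith.absolutelyContinuousOnInterval, ?_, rfl, rfl⟩, fun t _ => (hπK t).2⟩,
    ?_, ?_⟩
  · have hne : ∀ᵐ r : ℝ, r ≠ 0 ∧ r ≠ T' := by
      rw [eventually_and]
      constructor <;> simp [ae_iff, measure_singleton]
    filter_upwards [hπL.ae_differentiableAt_real, hne] with t hd ⟨ht0, htT⟩ hmem
    have h0t : 0 < t := lt_of_le_of_ne hmem.1 (Ne.symm ht0)
    have htT' : t < T' := lt_of_le_of_ne hmem.2 htT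
    have hX : π t ∈ S.X := hKX (hπK t).1
    -- On `[t, t + h]` the curve `Q i` moves by at most `M h`, and `Q i t` is eventually within `M
    -- h` of `π t`. By (SH3) its velocities lie within `2 k M h` of `F (π t)`; this thickening is
    -- closed and convex, so the mean value inclusion applies and survives the limit.
    have hslope : ∀ h ∈ Ioo 0 (T' - t),
        h⁻¹ • (π (t + h) - π t) ∈ Metric.cthickening (k * (2 * M * h)) (S.F (π t)) := by
      intro h hh
      have hev : ∀ᶠ i in l,
          h⁻¹ • (Q i (t + h) - Q i t) ∈ Metric.cthickening (k * (2 * M * h)) (S.F (π t)) := by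
        have hclose : ∀ᶠ i in l, ‖Q i t - π t‖ < M * h := by
          have := (tendsto_iff_norm_sub_tendsto_zero.1 (hπ t))
          exact this.eventually_lt_const (mul_pos hM0 hh.1)
        filter_upwards [hq, hlip, hclose,
          hT'.eventually_const_lt (show t + h < T' by linarith [hh.2]), hQK]
          with i ⟨hi, _, hiK⟩ hil hic hiT hiQ
        have hcl : ∀ s ∈ Icc t (t + h), Q i s = q i s := fun s hs => by
          have h1 : 0 ≤ s := h0t.le.trans hs.1
          have h2 : s ≤ T i := hs.2.trans hiT.le
          simp only [hQ]
          rw [min_eq_left h2, max_eq_right h1]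
        have hsub : Icc t (t + h) ⊆ Icc 0 (T i) := Icc_subset_Icc h0t.le hiT.le
        have hth : t ≤ t + h := by linarith [hh.1]
        have := (hi.absCont.mono (c := t) (d := t + h) (by
          rw [uIcc_of_le hth]; exact hsub.trans Icc_subset_uIcc)).smul_sub_mem_of_convex
          (by linarith [hh.1]) ((S.vel_convex _ hX).cthickening (k * (2 * M * h)))
          Metric.isClosed_cthickening (by
            filter_upwards [hi.deriv_mem] with s hs hsm
            obtain ⟨v, hv, hdv⟩ := hs (hsub hsm)
            refine ⟨v, F_subset_cthickening hk (hiK s (hsub hsm)) (hπK t).1 ?_ hv, hdv⟩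
            refine mul_le_mul_of_nonneg_left ?_ hk0.le
            have e1 := hil s t
            rw [abs_of_nonneg (by linarith [hsm.1])] at e1
            have e2 : M * (s - t) ≤ M * h :=
              mul_le_mul_of_nonneg_left (by linarith [hsm.2]) hM0.le
            have e3 := norm_sub_le_norm_sub_add_norm_sub (Q i s) (Q i t) (π t)
            rw [← hcl s hsm]
            linarith)
        rwa [add_sub_cancel_left, ← hcl _ ⟨hth, le_rfl⟩, ← hcl _ ⟨le_rfl, hth⟩] at this
      exact Metric.isClosed_cthickening.mem_of_tendsto
        (((hπ (t + h)).sub (hπ t)).const_smul _) hev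
    have hder := hd.hasDerivAt
    refine ⟨deriv π t, ?_, hder⟩
    rw [Metric.mem_iff_infEDist_zero_of_closed (isClosed_F hX), ← nonpos_iff_eq_zero]
    have hsl : Tendsto (fun h : ℝ => h⁻¹ • (π (t + h) - π t)) (𝓝[>] 0) (𝓝 (deriv π t)) :=
      (hasDerivAt_iff_tendsto_slope_zero.1 hder).mono_left
        (nhdsWithin_mono _ fun h hh => ne_of_gt hh)
    have hlim0 : Tendsto (fun h : ℝ => ENNReal.ofReal (k * (2 * M * h))) (𝓝[>] 0) (𝓝 0) := by
      have : Continuous fun h : ℝ => ENNReal.ofReal (k * (2 * M * h)) :=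
        ENNReal.continuous_ofReal.comp (by fun_prop)
      simpa using (this.tendsto 0).mono_left nhdsWithin_le_nhds
    refine le_of_tendsto_of_tendsto ((Metric.continuous_infEDist.tendsto _).comp hsl) hlim0 ?_
    filter_upwards [Ioo_mem_nhdsGT (sub_pos.2 htT')] with h hh
    exact Metric.mem_cthickening_iff.1 (hslope h hh)
  · refine (hπ 0).congr' ?_
    filter_upwards [hq] with i ⟨hi, _⟩
    simp only [hQ]
    rw [min_eq_left hi.nonneg, max_self, hi.start]
  · have hy : (fun i => Q i (T i)) =ᶠ[l] y := by
      filter_upwards [hq] with i ⟨hi, _⟩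
      simp only [hQ]
      rw [min_self, max_eq_right hi.nonneg, hi.finish]
    refine Tendsto.congr' hy ?_
    -- The final time varies with `i`; the uniform Lipschitz bound permits replacing it by `T'`.
    have h0 : Tendsto (fun i => Q i (T i) - Q i T') l (𝓝 0) := by
      refine squeeze_zero_norm' (hlip.mono fun i hi => hi (T i) T') ?_
      have := ((hT'.sub_const T').abs).const_mul M
      simpa using this
    simpa using h0.add (hπ T')

/-- A Gronwall bound in terms of the cost. -/
theorem IsAdmissible.norm_le_of_cost {x y : EuclideanSpace ℝ (Fin n)} {T : ℝ}
    {π : ℝ → EuclideanSpace ℝ (Fin n)} (h : S.IsAdmissible x y T π) {γ c : ℝ} (hγ : 0 < γ)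
    (hc : 0 < c) (hg : ∀ x ∈ S.X, ∀ v ∈ S.F x, ‖v‖ ≤ (γ * ‖x‖ + c) * S.ψ x v)
    {t : ℝ} (ht : t ∈ Icc 0 T) :
    γ * ‖π t‖ ≤ (c + γ * √(1 + ‖x‖ ^ 2)) * Real.exp (γ * (S.cost T π).toReal) := by
  -- A smooth substitute for `log (c + γ ‖x‖)`, chosen so that the growth condition gives `(G ∘ π)'
  -- ≤ γ ψ (π, π')`; integration bounds its increase by `γ` times the cost.
  set G : EuclideanSpace ℝ (Fin n) → ℝ := fun x => Real.log (c + γ * √(1 + ‖x‖ ^ 2)) with hG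
  have hpos : ∀ x : EuclideanSpace ℝ (Fin n), 0 < c + γ * √(1 + ‖x‖ ^ 2) := fun x => by positivity
  have hGd : ContDiff ℝ 1 G := by
    refine ContDiff.log (contDiff_const.add (contDiff_const.mul
      (ContDiff.sqrt (contDiff_const.add (contDiff_norm_sq ℝ)) fun x => ?_))) fun x => (hpos x).ne'
    positivity
  obtain ⟨R, hR⟩ := h.isCompact_image.isBounded.subset_closedBall 0
  obtain ⟨L, hL⟩ := (hGd.contDiffOn (s := Metric.closedBall 0 R)).exists_lipschitzOnWith one_ne_zero
    (convex_closedBall _ _) (isCompact_closedBall _ _)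
  have hsub : Icc 0 t ⊆ Icc 0 T := Icc_subset_Icc le_rfl ht.2
  have hac : AbsolutelyContinuousOnInterval (G ∘ π) 0 t := by
    refine hL.comp_absolutelyContinuousOnInterval (h.absCont.mono ?_) ?_
    · rw [uIcc_of_le ht.1]; exact hsub.trans Icc_subset_uIcc
    · rw [uIcc_of_le ht.1]; exact fun s hs => hR (mem_image_of_mem _ (hsub hs))
  have hder : ∀ᵐ s, s ∈ Icc 0 t → ENNReal.ofReal (deriv (G ∘ π) s) ≤
      ENNReal.ofReal γ * ENNReal.ofReal (S.ψ (π s) (deriv π s)) := by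
    filter_upwards [h.deriv_mem] with s hs hsm
    obtain ⟨v, hv, hd⟩ := hs (hsub hsm)
    rw [← ENNReal.ofReal_mul hγ.le]
    refine ENNReal.ofReal_le_ofReal ?_
    have h1 : (0 : ℝ) < 1 + ‖π s‖ ^ 2 := by positivity
    have hd' := ((((hd.norm_sq).const_add 1).sqrt h1.ne').const_mul γ |>.const_add c).log
      (hpos (π s)).ne'
    have hψ := S.ψ_pos _ (h.mem s (hsub hsm)) v hv
    have hv' := hg _ (h.mem s (hsub hsm)) v hv
    have e : deriv (G ∘ π) s = _ := hd'.deriv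
    rw [e, hd.deriv, div_le_iff₀ (hpos _)]
    have hsq : ‖π s‖ ≤ √(1 + ‖π s‖ ^ 2) := Real.le_sqrt_of_sq_le (by linarith)
    have hsq0 : 0 < √(1 + ‖π s‖ ^ 2) := Real.sqrt_pos.2 h1
    rw [mul_assoc]
    refine mul_le_mul_of_nonneg_left ?_ hγ.le
    rw [mul_div_mul_left _ _ two_ne_zero, div_le_iff₀ hsq0]
    calc inner ℝ (π s) v ≤ ‖π s‖ * ‖v‖ := real_inner_le_norm _ _
      _ ≤ √(1 + ‖π s‖ ^ 2) * ((γ * √(1 + ‖π s‖ ^ 2) + c) * S.ψ (π s) v) := by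
        gcongr
        exact hv'.trans (by gcongr)
      _ = _ := by ring
  have hle : ∫⁻ s in Icc 0 t, ENNReal.ofReal γ * ENNReal.ofReal (S.ψ (π s) (deriv π s)) ≤
      ENNReal.ofReal γ * S.cost T π := by
    rw [lintegral_const_mul' _ _ ENNReal.ofReal_ne_top]
    gcongr
    exact lintegral_mono_set hsub
  have hfin : ENNReal.ofReal γ * S.cost T π ≠ ∞ :=
    ENNReal.mul_ne_top ENNReal.ofReal_ne_top h.cost_lt_top.ne
  have key := (hac.sub_le_toReal_lintegral ht.1 hder (ne_top_of_le_ne_top hfin hle)).trans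
    (ENNReal.toReal_mono hfin hle)
  rw [ENNReal.toReal_mul, ENNReal.toReal_ofReal hγ.le] at key
  simp only [Function.comp_apply, h.start, hG] at key
  have h2 : c + γ * √(1 + ‖π t‖ ^ 2) ≤
      (c + γ * √(1 + ‖x‖ ^ 2)) * Real.exp (γ * (S.cost T π).toReal) := by
    rw [← Real.log_le_log_iff (hpos _) (mul_pos (hpos _) (Real.exp_pos _)),
      Real.log_mul (hpos _).ne' (Real.exp_pos _).ne', Real.log_exp]
    linarith
  refine le_trans ?_ h2
  have hsq : ‖π t‖ ≤ √(1 + ‖π t‖ ^ 2) := Real.le_sqrt_of_sq_le (by linarith)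
  nlinarith

theorem exists_isAdmissible_of_clr_lt {x : EuclideanSpace ℝ (Fin n)} {C : ℝ≥0∞}
    (h : S.clr x < C) :
    ∃ y T π, y ∈ S.obst ∧ S.IsAdmissible x y T π ∧ S.cost T π < C := by
  simp only [clr, dist, iInf_lt_iff] at h
  obtain ⟨y, hy, T, π, hπ, hc⟩ := h
  exact ⟨y, T, π, hy, hπ, hc⟩

/-- Under linear growth of the velocities per unit of cost, the set where the clearance is finite
contains limits of points of bounded clearance. -/
theorem clr_lt_top_of_tendsto (hX : IsClosed S.X) (hS : S.CostLinearGrowth) {ι : Type*}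
    {l : Filter ι} [NeBot l] {p : ι → EuclideanSpace ℝ (Fin n)} {x : EuclideanSpace ℝ (Fin n)}
    (hp : Tendsto p l (𝓝 x)) {C : ℝ≥0∞} (hC : C ≠ ∞) (h : ∀ᶠ i in l, S.clr (p i) < C) :
    S.clr x < ∞ := by
  obtain ⟨γ, hγ, c, hc, hg⟩ := hS
  choose! y T q hyo hq hqC using
    fun i (hi : S.clr (p i) < C) => exists_isAdmissible_of_clr_lt hi
  -- The Gronwall radius for starting points of norm at most `‖x‖ + 1` and cost at most `C`.
  set R : ℝ := (c + γ * √(1 + (‖x‖ + 1) ^ 2)) * Real.exp (γ * C.toReal) / γ with hR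
  set K : Set (EuclideanSpace ℝ (Fin n)) := S.X ∩ Metric.closedBall 0 R with hK
  have hKc : IsCompact K := (isCompact_closedBall _ _).inter_left hX
  obtain ⟨a, ha, _, -, hψ⟩ := exists_bounds_of_isCompact hKc inter_subset_left
  have hnorm : ∀ᶠ i in l, ‖p i‖ < ‖x‖ + 1 := hp.norm.eventually_lt_const (lt_add_one _)
  have hbd : ∀ᶠ i in l, S.IsAdmissible (p i) (y i) (T i) (q i) ∧ T i ≤ C.toReal / a ∧
      ∀ t ∈ Icc 0 (T i), q i t ∈ K := by
    filter_upwards [h, hnorm] with i hi hin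
    have hKi : ∀ t ∈ Icc 0 (T i), q i t ∈ K := by
      intro t ht
      refine ⟨(hq i hi).mem t ht, ?_⟩
      rw [mem_closedBall_zero_iff, hR, le_div_iff₀' hγ]
      refine ((hq i hi).norm_le_of_cost hγ hc hg ht).trans ?_
      gcongr
      exact (hqC i hi).le
    refine ⟨hq i hi, ?_, hKi⟩
    -- With `ψ ≥ a` on `K`, a cost below `C` leaves a duration of at most `C / a`.
    have h1 := ((hq i hi).le_cost ha.le fun t ht v hv => (hψ _ (hKi t ht) v hv).1).trans
      (hqC i hi).le
    rw [le_div_iff₀' ha]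
    exact (ENNReal.ofReal_le_iff_le_toReal hC).1 h1
  obtain ⟨x', z, T', π, hπ, hx', hz⟩ := exists_isAdmissible_of_ultrafilter
    (l := Ultrafilter.of l) hKc inter_subset_left (hbd.filter_mono (Ultrafilter.of_le l))
  obtain rfl := tendsto_nhds_unique hx' (hp.mono_left (Ultrafilter.of_le l))
  have hzo : z ∈ S.obst := by
    refine S.obst_closed ⟨mem_closure_of_tendsto hz ?_, ?_⟩
    · exact (h.mono fun i hi => hyo i hi).filter_mono (Ultrafilter.of_le l)
    · rw [← hπ.finish]; exact hπ.mem T' ⟨hπ.nonneg, le_rfl⟩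
  exact (iInf_le_of_le z (iInf_le _ hzo)).trans_lt (hπ.dist_le.trans_lt hπ.cost_lt_top)

/-! ### Jumps of the clearance and the wave envelope. -/

theorem IsAdmissible.mem_bdry_wave {x y : EuclideanSpace ℝ (Fin n)} {T : ℝ}
    {π : ℝ → EuclideanSpace ℝ (Fin n)} (hπ : S.IsAdmissible x y T π) {τ : ℝ} (hτ : τ ∈ Ioo 0 T)
    (hfree : π τ ∈ S.free) {L R : ℝ≥0∞}
    (hL : Tendsto (fun t => S.clr (π t)) (𝓝[<] τ) (𝓝 L))
    (hR : Tendsto (fun t => S.clr (π t)) (𝓝[>] τ) (𝓝 R)) {ρ : ℝ}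
    (hLρ : L < ENNReal.ofReal ρ) (hρR : ENNReal.ofReal ρ < R) : π τ ∈ S.bdry (S.wave ρ) := by
  have hcont : ContinuousAt π τ := hπ.continuousOn.continuousAt (Icc_mem_nhds hτ.1 hτ.2)
  have hnot : π τ ∉ closure S.obst := fun hm => hfree.2 (S.obst_closed ⟨hm, hfree.1⟩)
  -- Low clearance alone does not put a point in the wave; it must also be free, which holds near
  -- `τ` because the obstacle set is relatively closed.
  have hfr : ∀ᶠ t in 𝓝 τ, π t ∈ S.free := by
    filter_upwards [hcont.eventually (isClosed_closure.isOpen_compl.mem_nhds hnot),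
      Icc_mem_nhds hτ.1 hτ.2] with t ht htm
    exact ⟨hπ.mem t htm, fun ho => ht (subset_closure ho)⟩
  refine ⟨⟨hfree.1, ?_⟩, ?_⟩
  · refine mem_closure_of_tendsto (hcont.tendsto.mono_left (nhdsWithin_le_nhds (s := Iio τ))) ?_
    filter_upwards [hfr.filter_mono nhdsWithin_le_nhds, hL.eventually_lt_const hLρ] with t h1 h2
    exact ⟨h1, h2⟩
  · refine mem_closure_of_tendsto (hcont.tendsto.mono_left (nhdsWithin_le_nhds (s := Ioi τ))) ?_
    filter_upwards [hfr.filter_mono nhdsWithin_le_nhds, hR.eventually_const_lt hρR] with t h1 h2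
    exact ⟨h1.1, fun hw => lt_asymm hw.2 h2⟩

end ControlSystem

theorem mainTheorem5 {n m : ℕ} (S : ControlSystem n m)
    (x y : EuclideanSpace ℝ (Fin n)) (T : ℝ) (π : ℝ → EuclideanSpace ℝ (Fin n))
    (hπ : S.IsAdmissible x y T π) (τ : ℝ) (hτ : τ ∈ Ioo 0 T)
    (hdisc : ¬ ContinuousAt (fun t => S.clr (π t)) τ) :
    (∃ L R : ℝ≥0∞,
      Tendsto (fun t => S.clr (π t)) (𝓝[<] τ) (𝓝 L) ∧
      Tendsto (fun t => S.clr (π t)) (𝓝[>] τ) (𝓝 R) ∧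
      L < R) ∧
    (π τ ∈ S.free →
      S.clr (π τ) < ∞ ∨ (IsClosed S.X ∧ S.CostLinearGrowth) →
      π τ ∈ S.envelope) := by
  obtain ⟨L, R, hL, hR, hLτ, hτR⟩ := hπ.exists_clr_limits hτ
  have hLR : L < R := by
    refine lt_of_le_of_ne (hLτ.trans hτR) fun heq => hdisc ?_
    have h1 : S.clr (π τ) = L := le_antisymm (heq ▸ hτR) hLτ
    rw [continuousAt_iff_continuous_left'_right']
    refine ⟨?_, ?_⟩
    · change Tendsto _ _ (𝓝 (S.clr (π τ)))
      rwa [h1]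
    · change Tendsto _ _ (𝓝 (S.clr (π τ)))
      rwa [h1, heq]
  refine ⟨⟨L, R, hL, hR, hLR⟩, fun hfree hor => ⟨hfree, ?_⟩⟩
  have hfin : S.clr (π τ) ≠ ∞ := by
    rcases hor with h | ⟨hX, hS⟩
    · exact h.ne
    -- Even if `R = ∞`, a level `C` strictly below `R` is finite and bounds the clearance just
    -- before `τ`.
    · obtain ⟨C, hLC, hCR⟩ := exists_between hLR
      have hcont : ContinuousAt π τ := hπ.continuousOn.continuousAt (Icc_mem_nhds hτ.1 hτ.2)
      exact (S.clr_lt_top_of_tendsto hX hS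
        (hcont.tendsto.mono_left (nhdsWithin_le_nhds (s := Iio τ))) hCR.ne_top
        (hL.eventually_lt_const hLC)).ne
  -- Two distinct levels inside the jump suffice: first arrival is at most `a`, last arrival at
  -- least `b`.
  obtain ⟨b, hLb, hbR⟩ := exists_between hLR
  obtain ⟨a, hLa, hab⟩ := exists_between hLb
  have hmem : ∀ c, L < c → c < R → 0 < c.toReal ∧ π τ ∈ S.bdry (S.wave c.toReal) := by
    intro c h1 h2
    have h3 := ENNReal.ofReal_toReal h2.ne_top
    exact ⟨ENNReal.toReal_pos (bot_le.trans_lt h1).ne' h2.ne_top,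
      hπ.mem_bdry_wave hτ hfree hL hR (by rwa [h3]) (by rwa [h3])⟩
  rw [ControlSystem.rhoMin, ControlSystem.rhoMax, if_neg hfin, if_neg hfin]
  calc _ ≤ ENNReal.ofReal a.toReal := iInf₂_le a.toReal (hmem a hLa (hab.trans hbR))
    _ < ENNReal.ofReal b.toReal := by
      rwa [ENNReal.ofReal_toReal (hab.trans hbR).ne_top, ENNReal.ofReal_toReal hbR.ne_top]
    _ ≤ _ := le_iSup₂ (f := fun (ρ : ℝ) (_ : 0 < ρ ∧ π τ ∈ S.bdry (S.wave ρ)) => ENNReal.ofReal ρ)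
        _ (hmem b hLb hbR)
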